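/- Let $M$ be a smooth finite-dimensional manifold (boundary and corners are allowed; in particular $M$ may be any smooth, compact, oriented 4-manifold), and let $(g,J,\omega)$ be an almost-Kähler structure on $M$. That is, $\omega$ is a symplectic form (a smooth nondegenerate 2-form with $d\omega=0$); $J$ is a smooth almost-complex structure ($J^2=-1$) compatible with $\omega$, i.e. $\omega(Jv,Jw)=\omega(v,w)$ for all tangent vectors $v,w$ at a common point, and $\omega(v,Jv)>0$ for all $v\neq 0$; and $g$ is the associated Riemannian metric $g(v,w)=\omega(v,Jw)$. Let $N$ be the Nijenhuis tensor of $J$, $$N(X,Y)=[JX,JY]-J[JX,Y]-J[X,JY]-[X,Y],$$ and let $\nabla$ be the Levi-Civita connection of $g$. Then the zero set of $N$ is equal to the zero set of $\nabla\omega$: for every $x\in M$, one has $N_x=0$ if and only if $(\nabla\omega)_x=0$. -/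

import Mathlib

open Bundle FiberBundle VectorField
open scoped Manifold ContDiff

noncomputable section

namespace AlmostKahler

variable {E : Type*} [NormedAddCommGroup E] [NormedSpace ℝ E]
  {H : Type*} [TopologicalSpace H] {I : ModelWithCorners ℝ E H}
  {M : Type*} [TopologicalSpace M] [ChartedSpace H M]

/-! ### Fields of bilinear forms -/

/-- A (not necessarily smooth) field of bilinear forms on the tangent spaces of `M`. -/
abbrev BilinField {E : Type*} [NormedAddCommGroup E] [NormedSpace ℝ E]
    {H : Type*} [TopologicalSpace H] (I : ModelWithCorners ℝ E H)
    (M : Type*) [TopologicalSpace M] [ChartedSpace H M] :=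
  Π x : M, TangentSpace I x →L[ℝ] TangentSpace I x →L[ℝ] ℝ

/-- Smoothness of a field of bilinear forms, as a section of the bundle `Hom(TM, Hom(TM, ℝ))`. -/
def BilinField.IsSmooth [IsManifold I ∞ M] (B : BilinField I M) : Prop :=
  ContMDiff I (I.prod 𝓘(ℝ, E →L[ℝ] E →L[ℝ] ℝ)) ∞
    (fun x ↦ TotalSpace.mk' (E →L[ℝ] E →L[ℝ] ℝ)
      (E := fun x : M ↦ TangentSpace I x →L[ℝ] TangentSpace I x →L[ℝ] ℝ) x (B x))

theorem BilinField.IsSmooth.mdifferentiableAt [IsManifold I ∞ M] {B : BilinField I M}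
    (hB : B.IsSmooth) {X Y : Π x : M, TangentSpace I x} {x : M}
    (hX : MDiffAt (T% X) x) (hY : MDiffAt (T% Y) x) :
    MDiffAt (fun y ↦ B y (X y) (Y y)) x := by
  have : MDifferentiableAt I (I.prod 𝓘(ℝ))
      (fun m ↦ TotalSpace.mk' ℝ (E := Bundle.Trivial M ℝ) m (B m (X m) (Y m))) x := by
    apply MDifferentiableAt.clm_bundle_apply₂ (F₁ := E) (F₂ := E)
      (E₁ := fun x : M ↦ TangentSpace I x) (E₂ := fun x : M ↦ TangentSpace I x)
    · exact (ContMDiff.contMDiffAt hB).mdifferentiableAt (by simp)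
    · exact hX
    · exact hY
  simp only [mdifferentiableAt_totalSpace] at this
  exact this.2

variable [FiniteDimensional ℝ E] [IsManifold I ∞ M]

/-! ### The Levi-Civita connection of a Riemannian metric -/

section LeviCivita

/-- A smooth Riemannian metric on `M`. -/
abbrev RiemMetric {E : Type*} [NormedAddCommGroup E] [NormedSpace ℝ E]
    {H : Type*} [TopologicalSpace H] (I : ModelWithCorners ℝ E H)
    (M : Type*) [TopologicalSpace M] [ChartedSpace H M] [IsManifold I ∞ M] :=
  ContMDiffRiemannianMetric I ∞ E (fun x : M ↦ TangentSpace I x)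

variable (g : RiemMetric I M)

theorem RiemMetric.isSmooth : BilinField.IsSmooth (I := I) (M := M) g.inner := g.contMDiff

/-- The right-hand side of the Koszul formula: the value of `2 g(∇_X Y, Z)` at `x`. -/
def koszul (X Y Z : Π x : M, TangentSpace I x) (x : M) : ℝ :=
  d% (fun y ↦ g.inner y (Y y) (Z y)) x (X x) + d% (fun y ↦ g.inner y (X y) (Z y)) x (Y x)
    - d% (fun y ↦ g.inner y (X y) (Y y)) x (Z x)
    + g.inner x (mlieBracket I X Y x) (Z x) - g.inner x (mlieBracket I X Z x) (Y x)
    - g.inner x (mlieBracket I Y Z x) (X x)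

theorem koszul_tensorial_left {Y Z : Π x : M, TangentSpace I x} {x : M}
    (hY : MDiffAt (T% Y) x) (hZ : MDiffAt (T% Z) x) :
    TensorialAt I E (fun X ↦ koszul g X Y Z x) x where
  smul {f X} hf hX := by
    have : CompleteSpace E := FiniteDimensional.complete ℝ E
    simp [koszul, mvfderiv_fun_mul hf (g.isSmooth.mdifferentiableAt hX hZ),
      mvfderiv_fun_mul hf (g.isSmooth.mdifferentiableAt hX hY), mlieBracket_smul_left hf hX]
    ring
  add {X X'} hX hX' := by
    have : CompleteSpace E := FiniteDimensional.complete ℝ E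
    simp [koszul, mvfderiv_fun_add (g.isSmooth.mdifferentiableAt hX hZ)
      (g.isSmooth.mdifferentiableAt hX' hZ), mvfderiv_fun_add (g.isSmooth.mdifferentiableAt hX hY)
      (g.isSmooth.mdifferentiableAt hX' hY), mlieBracket_add_left hX hX']
    ring

theorem koszul_tensorial_right {X Y : Π x : M, TangentSpace I x} {x : M}
    (hX : MDiffAt (T% X) x) (hY : MDiffAt (T% Y) x) :
    TensorialAt I E (fun Z ↦ koszul g X Y Z x) x where
  smul {f Z} hf hZ := by
    have : CompleteSpace E := FiniteDimensional.complete ℝ E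
    simp [koszul, mvfderiv_fun_mul hf (g.isSmooth.mdifferentiableAt hX hZ),
      mvfderiv_fun_mul hf (g.isSmooth.mdifferentiableAt hY hZ), mlieBracket_smul_right hf hZ]
    rw [g.symm x (Z x) (X x), g.symm x (Z x) (Y x)]
    ring
  add {Z Z'} hZ hZ' := by
    have : CompleteSpace E := FiniteDimensional.complete ℝ E
    simp [koszul, mvfderiv_fun_add (g.isSmooth.mdifferentiableAt hX hZ)
      (g.isSmooth.mdifferentiableAt hX hZ'), mvfderiv_fun_add (g.isSmooth.mdifferentiableAt hY hZ)
      (g.isSmooth.mdifferentiableAt hY hZ'), mlieBracket_add_right hZ hZ']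
    ring

/-- For a vector field `Y` differentiable at `x`, the bilinear form `(X, Z) ↦ 2 g(∇_X Y, Z)` on
the tangent space at `x`, given by the Koszul formula. -/
def koszulForm {Y : Π x : M, TangentSpace I x} {x : M} (hY : MDiffAt (T% Y) x) :
    TangentSpace I x →L[ℝ] TangentSpace I x →L[ℝ] ℝ :=
  TensorialAt.mkHom₂ (fun X Z ↦ koszul g X Y Z x) x
    (fun _ hZ ↦ koszul_tensorial_left g hY hZ) (fun _ hX ↦ koszul_tensorial_right g hX hY)

theorem koszulForm_apply {X Y Z : Π x : M, TangentSpace I x} {x : M}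
    (hX : MDiffAt (T% X) x) (hY : MDiffAt (T% Y) x) (hZ : MDiffAt (T% Z) x) :
    koszulForm g hY (X x) (Z x) = koszul g X Y Z x :=
  TensorialAt.mkHom₂_apply _ _ hX hZ

theorem exists_sharp (x : M) (B : TangentSpace I x →L[ℝ] TangentSpace I x →L[ℝ] ℝ) :
    ∃ A : TangentSpace I x →L[ℝ] TangentSpace I x, ∀ u v, g.inner x (A u) v = B u v := by
  have : FiniteDimensional ℝ (TangentSpace I x) := inferInstanceAs (FiniteDimensional ℝ E)
  have : T2Space (TangentSpace I x) := inferInstanceAs (T2Space E)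
  let f : TangentSpace I x →ₗ[ℝ] Module.Dual ℝ (TangentSpace I x) :=
    (ContinuousLinearMap.coeLM ℝ) ∘ₗ (g.inner x).toLinearMap
  have hf : Function.Injective f := by
    rw [injective_iff_map_eq_zero]
    intro v hv
    by_contra h
    have := g.pos x v h
    have h2 : f v v = 0 := by rw [hv]; rfl
    exact this.ne' h2
  let e := LinearEquiv.ofInjectiveOfFinrankEq f hf Subspace.dual_finrank_eq.symm
  refine ⟨LinearMap.toContinuousLinearMap
    (e.symm.toLinearMap ∘ₗ (ContinuousLinearMap.coeLM ℝ) ∘ₗ B.toLinearMap), fun u v ↦ ?_⟩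
  have := congr($(e.apply_symm_apply (ContinuousLinearMap.coeLM ℝ (B u))) v)
  exact this

/-- The endomorphism `A` with `g(A u, v) = B(u, v)`. -/
def sharp (x : M) (B : TangentSpace I x →L[ℝ] TangentSpace I x →L[ℝ] ℝ) :
    TangentSpace I x →L[ℝ] TangentSpace I x :=
  (exists_sharp g x B).choose

theorem inner_sharp (x : M) (B : TangentSpace I x →L[ℝ] TangentSpace I x →L[ℝ] ℝ)
    (u v : TangentSpace I x) : g.inner x (sharp g x B u) v = B u v :=
  (exists_sharp g x B).choose_spec u v

theorem RiemMetric.ext_left {x : M} {u v : TangentSpace I x}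
    (h : ∀ w, g.inner x u w = g.inner x v w) : u = v := by
  by_contra hne
  have := g.pos x (u - v) (sub_ne_zero.2 hne)
  have h2 : g.inner x (u - v) (u - v) = 0 := by
    have := h (u - v)
    rw [(g.inner x).map_sub, sub_apply, this, sub_self]
  exact this.ne' h2

open Classical in
/-- `∇ Y` for the Levi-Civita connection of `g`, determined by the Koszul formula at the points
where the vector field `Y` is differentiable (the value elsewhere is irrelevant). -/
def leviCivitaFun (Y : Π x : M, TangentSpace I x) (x : M) :
    TangentSpace I x →L[ℝ] TangentSpace I x :=
  if hY : MDiffAt (T% Y) x then sharp g x ((1 / 2 : ℝ) • koszulForm g hY) else 0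

theorem inner_leviCivitaFun {X Y Z : Π x : M, TangentSpace I x} {x : M}
    (hX : MDiffAt (T% X) x) (hY : MDiffAt (T% Y) x) (hZ : MDiffAt (T% Z) x) :
    g.inner x (leviCivitaFun g Y x (X x)) (Z x) = (1 / 2) * koszul g X Y Z x := by
  rw [leviCivitaFun, dif_pos hY, inner_sharp]
  simp [← koszulForm_apply g hX hY hZ]

theorem leviCivitaFun_ext {x : M} {A B : TangentSpace I x →L[ℝ] TangentSpace I x}
    (h : ∀ X Z : Π x : M, TangentSpace I x, MDiffAt (T% X) x → MDiffAt (T% Z) x →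
      g.inner x (A (X x)) (Z x) = g.inner x (B (X x)) (Z x)) : A = B := by
  ext u
  refine g.ext_left fun w ↦ ?_
  simpa using h (extend E u) (extend E w) (mdifferentiableAt_extend ..)
    (mdifferentiableAt_extend ..)

/-- The Levi-Civita connection of the Riemannian metric `g`. -/
def leviCivita : CovariantDerivative I E (fun x : M ↦ TangentSpace I x) where
  toFun := leviCivitaFun g
  isCovariantDerivativeOnUniv :=
    { add := by
        intro Y Y' x hY hY' _
        have : CompleteSpace E := FiniteDimensional.complete ℝ E
        refine leviCivitaFun_ext g fun X Z hX hZ ↦ ?_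
        rw [inner_leviCivitaFun g hX (mdifferentiableAt_add_section hY hY') hZ]
        simp only [add_apply, map_add]
        rw [inner_leviCivitaFun g hX hY hZ, inner_leviCivitaFun g hX hY' hZ]
        simp [koszul, mvfderiv_fun_add (g.isSmooth.mdifferentiableAt hY hZ)
          (g.isSmooth.mdifferentiableAt hY' hZ),
          mvfderiv_fun_add (g.isSmooth.mdifferentiableAt hX hY)
          (g.isSmooth.mdifferentiableAt hX hY'), mlieBracket_add_left hY hY',
          mlieBracket_add_right hY hY']
        ring
      leibniz := by
        intro Y f x hY hf _
        have : CompleteSpace E := FiniteDimensional.complete ℝ E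
        refine leviCivitaFun_ext g fun X Z hX hZ ↦ ?_
        rw [inner_leviCivitaFun g hX (hf.smul_section hY) hZ]
        simp only [add_apply, map_add, smul_apply,
          map_smul, ContinuousLinearMap.smulRight_apply]
        rw [inner_leviCivitaFun g hX hY hZ]
        simp [koszul, mvfderiv_fun_mul hf (g.isSmooth.mdifferentiableAt hY hZ),
          mvfderiv_fun_mul hf (g.isSmooth.mdifferentiableAt hX hY), mlieBracket_smul_left hf hY,
          mlieBracket_smul_right hf hY]
        rw [g.symm x (Y x) (X x)]
        ring }

/-- The Levi-Civita connection is compatible with the metric. -/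
theorem leviCivita_metric {X Y Z : Π x : M, TangentSpace I x} {x : M}
    (hX : MDiffAt (T% X) x) (hY : MDiffAt (T% Y) x) (hZ : MDiffAt (T% Z) x) :
    d% (fun y ↦ g.inner y (Y y) (Z y)) x (X x) =
      g.inner x (leviCivita g Y x (X x)) (Z x) + g.inner x (Y x) (leviCivita g Z x (X x)) := by
  rw [g.symm x (Y x)]
  change _ = g.inner x (leviCivitaFun g Y x (X x)) (Z x)
    + g.inner x (leviCivitaFun g Z x (X x)) (Y x)
  rw [inner_leviCivitaFun g hX hY hZ, inner_leviCivitaFun g hX hZ hY]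
  simp only [koszul, mlieBracket_swap_apply (V := Z) (W := Y), map_neg,
    neg_apply, g.symm _ (Z _) (Y _)]
  ring

/-- The Levi-Civita connection is torsion-free. -/
theorem leviCivita_torsion {X Y : Π x : M, TangentSpace I x} {x : M}
    (hX : MDiffAt (T% X) x) (hY : MDiffAt (T% Y) x) :
    leviCivita g Y x (X x) - leviCivita g X x (Y x) = mlieBracket I X Y x := by
  refine g.ext_left fun w ↦ ?_
  have hZ : MDiffAt (T% (extend E w : Π x : M, TangentSpace I x)) x := mdifferentiableAt_extend ..
  have h1 := inner_leviCivitaFun g hX hY hZ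
  have h2 := inner_leviCivitaFun g hY hX hZ
  have hw : (extend E w : Π x : M, TangentSpace I x) x = w := by simp
  rw [map_sub, sub_apply]
  change g.inner x (leviCivitaFun g Y x (X x)) w - g.inner x (leviCivitaFun g X x (Y x)) w = _
  rw [← hw, h1, h2]
  simp only [koszul, mlieBracket_swap_apply (V := Y) (W := X), map_neg,
    neg_apply, g.symm _ (Y _) (X _)]
  ring

end LeviCivita

/-! ### The covariant derivative and the exterior derivative of a 2-form -/

section TwoForms

/-- The expression `X (Ω(Y, Z)) - Ω(∇_X Y, Z) - Ω(Y, ∇_X Z)` at `x`, as a linear form in `X`. -/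
def covDerivAux (cov : CovariantDerivative I E (fun x : M ↦ TangentSpace I x))
    (Ω : BilinField I M) (Y Z : Π x : M, TangentSpace I x) (x : M) :
    TangentSpace I x →L[ℝ] ℝ :=
  have : FiniteDimensional ℝ (TangentSpace I x) := inferInstanceAs (FiniteDimensional ℝ E)
  have : T2Space (TangentSpace I x) := inferInstanceAs (T2Space E)
  LinearMap.toContinuousLinearMap
    { toFun u := d% (fun y ↦ Ω y (Y y) (Z y)) x u - Ω x (cov Y x u) (Z x) - Ω x (Y x) (cov Z x u)
      map_add' u v := by simp; ring
      map_smul' c u := by simp; ring }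

theorem covDerivAux_tensorial_left (cov : CovariantDerivative I E (fun x : M ↦ TangentSpace I x))
    {Ω : BilinField I M} (hΩ : Ω.IsSmooth) {Z : Π x : M, TangentSpace I x} {x : M}
    (hZ : MDiffAt (T% Z) x) : TensorialAt I E (fun Y ↦ covDerivAux cov Ω Y Z x) x where
  smul {f Y} hf hY := by
    ext u
    simp [covDerivAux, mvfderiv_fun_mul hf (hΩ.mdifferentiableAt hY hZ),
      cov.isCovariantDerivativeOn.leibniz hY hf]
    ring
  add {Y Y'} hY hY' := by
    ext u
    simp [covDerivAux, mvfderiv_fun_add (hΩ.mdifferentiableAt hY hZ)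
      (hΩ.mdifferentiableAt hY' hZ), cov.isCovariantDerivativeOn.add hY hY']
    ring

theorem covDerivAux_tensorial_right (cov : CovariantDerivative I E (fun x : M ↦ TangentSpace I x))
    {Ω : BilinField I M} (hΩ : Ω.IsSmooth) {Y : Π x : M, TangentSpace I x} {x : M}
    (hY : MDiffAt (T% Y) x) : TensorialAt I E (fun Z ↦ covDerivAux cov Ω Y Z x) x where
  smul {f Z} hf hZ := by
    ext u
    simp [covDerivAux, mvfderiv_fun_mul hf (hΩ.mdifferentiableAt hY hZ),
      cov.isCovariantDerivativeOn.leibniz hZ hf]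
    ring
  add {Z Z'} hZ hZ' := by
    ext u
    simp [covDerivAux, mvfderiv_fun_add (hΩ.mdifferentiableAt hY hZ)
      (hΩ.mdifferentiableAt hY hZ'), cov.isCovariantDerivativeOn.add hZ hZ']
    ring

/-- The covariant derivative `∇Ω` of a smooth field of bilinear forms, as a tensor:
`covDeriv cov hΩ x (Y x) (Z x) (X x)` is the value at `x` of
`(∇_X Ω)(Y, Z) = X (Ω(Y, Z)) - Ω(∇_X Y, Z) - Ω(Y, ∇_X Z)`. -/
def covDeriv (cov : CovariantDerivative I E (fun x : M ↦ TangentSpace I x))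
    {Ω : BilinField I M} (hΩ : Ω.IsSmooth) (x : M) :
    TangentSpace I x →L[ℝ] TangentSpace I x →L[ℝ] TangentSpace I x →L[ℝ] ℝ :=
  TensorialAt.mkHom₂ (fun Y Z ↦ covDerivAux cov Ω Y Z x) x
    (fun _ hZ ↦ covDerivAux_tensorial_left cov hΩ hZ)
    (fun _ hY ↦ covDerivAux_tensorial_right cov hΩ hY)

theorem covDeriv_apply (cov : CovariantDerivative I E (fun x : M ↦ TangentSpace I x))
    {Ω : BilinField I M} (hΩ : Ω.IsSmooth) {X Y Z : Π x : M, TangentSpace I x} {x : M}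
    (hY : MDiffAt (T% Y) x) (hZ : MDiffAt (T% Z) x) :
    covDeriv cov hΩ x (Y x) (Z x) (X x) = d% (fun y ↦ Ω y (Y y) (Z y)) x (X x)
      - Ω x (cov Y x (X x)) (Z x) - Ω x (Y x) (cov Z x (X x)) := by
  rw [covDeriv, TensorialAt.mkHom₂_apply _ _ hY hZ]
  simp [covDerivAux]

/-- The value `dΩ(X, Y, Z)` at `x` of the exterior derivative of a 2-form, on three vector fields
(Cartan's formula). -/
def extDerivTwo (Ω : BilinField I M) (X Y Z : Π x : M, TangentSpace I x) (x : M) : ℝ :=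
  d% (fun y ↦ Ω y (Y y) (Z y)) x (X x) - d% (fun y ↦ Ω y (X y) (Z y)) x (Y x)
    + d% (fun y ↦ Ω y (X y) (Y y)) x (Z x)
    - Ω x (mlieBracket I X Y x) (Z x) + Ω x (mlieBracket I X Z x) (Y x)
    - Ω x (mlieBracket I Y Z x) (X x)

end TwoForms

/-! ### Almost-complex structures and the Nijenhuis tensor -/

/-- A smooth almost-complex structure on `M`: a smooth section `J` of `Hom(TM, TM)` such that
`J² = -1`. -/
structure AlmostComplexStructure {E : Type*} [NormedAddCommGroup E] [NormedSpace ℝ E]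
    {H : Type*} [TopologicalSpace H] (I : ModelWithCorners ℝ E H)
    (M : Type*) [TopologicalSpace M] [ChartedSpace H M] [IsManifold I ∞ M] where
  /-- the endomorphism of each tangent space -/
  toFun : Π x : M, TangentSpace I x →L[ℝ] TangentSpace I x
  smooth : ContMDiff I (I.prod 𝓘(ℝ, E →L[ℝ] E)) ∞
    (fun x ↦ TotalSpace.mk' (E →L[ℝ] E)
      (E := fun x : M ↦ TangentSpace I x →L[ℝ] TangentSpace I x) x (toFun x))
  sq_eq_neg : ∀ (x : M) (v : TangentSpace I x), toFun x (toFun x v) = -v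

namespace AlmostComplexStructure

variable (J : AlmostComplexStructure I M)

/-- The vector field `JX`. -/
def field (X : Π x : M, TangentSpace I x) : Π x : M, TangentSpace I x := fun x ↦ J.toFun x (X x)

theorem mdifferentiableAt_field {X : Π x : M, TangentSpace I x} {x : M}
    (hX : MDiffAt (T% X) x) : MDiffAt (T% (J.field X)) x :=
  MDifferentiableAt.clm_bundle_apply (F₁ := E) (F₂ := E)
    (E₁ := fun x : M ↦ TangentSpace I x) (E₂ := fun x : M ↦ TangentSpace I x)
    ((ContMDiff.contMDiffAt J.smooth).mdifferentiableAt (by simp)) hX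

theorem field_add (X Y : Π x : M, TangentSpace I x) :
    J.field (X + Y) = J.field X + J.field Y := by
  ext x; simp [field]

theorem field_smul (f : M → ℝ) (X : Π x : M, TangentSpace I x) :
    J.field (f • X) = f • J.field X := by
  ext x; simp [field]

/-- The expression `[JX, JY] - J[JX, Y] - J[X, JY] - [X, Y]` at `x`. -/
def nijenhuisAux (X Y : Π x : M, TangentSpace I x) (x : M) : TangentSpace I x :=
  mlieBracket I (J.field X) (J.field Y) x - J.toFun x (mlieBracket I (J.field X) Y x)
    - J.toFun x (mlieBracket I X (J.field Y) x) - mlieBracket I X Y x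

theorem nijenhuisAux_swap (X Y : Π x : M, TangentSpace I x) (x : M) :
    J.nijenhuisAux X Y x = - J.nijenhuisAux Y X x := by
  simp only [nijenhuisAux, mlieBracket_swap_apply (V := Y), map_neg,
    mlieBracket_swap_apply (V := J.field Y)]
  abel

theorem nijenhuisAux_tensorial_left (Y : Π x : M, TangentSpace I x) (x : M) :
    TensorialAt I E (fun X ↦ J.nijenhuisAux X Y x) x where
  smul {f X} hf hX := by
    have : CompleteSpace E := FiniteDimensional.complete ℝ E
    simp only [nijenhuisAux, field_smul, mlieBracket_smul_left hf hX,
      mlieBracket_smul_left hf (J.mdifferentiableAt_field hX), map_add, map_smul]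
    simp only [field, J.sq_eq_neg]
    module
  add {X X'} hX hX' := by
    have : CompleteSpace E := FiniteDimensional.complete ℝ E
    simp only [nijenhuisAux, field_add, mlieBracket_add_left hX hX',
      mlieBracket_add_left (J.mdifferentiableAt_field hX) (J.mdifferentiableAt_field hX'), map_add]
    abel

theorem nijenhuisAux_tensorial_right (X : Π x : M, TangentSpace I x) (x : M) :
    TensorialAt I E (fun Y ↦ J.nijenhuisAux X Y x) x where
  smul {f Y} hf hY := by
    rw [nijenhuisAux_swap, (J.nijenhuisAux_tensorial_left X x).smul hf hY, nijenhuisAux_swap J X]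
    module
  add {Y Y'} hY hY' := by
    rw [nijenhuisAux_swap, (J.nijenhuisAux_tensorial_left X x).add hY hY', nijenhuisAux_swap J X,
      nijenhuisAux_swap J X]
    abel

/-- The Nijenhuis tensor `N(X, Y) = [JX, JY] - J[JX, Y] - J[X, JY] - [X, Y]` of `J`. -/
def nijenhuis (x : M) : TangentSpace I x →L[ℝ] TangentSpace I x →L[ℝ] TangentSpace I x :=
  TensorialAt.mkHom₂ (fun X Y ↦ J.nijenhuisAux X Y x) x
    (fun Y _ ↦ J.nijenhuisAux_tensorial_left Y x) (fun X _ ↦ J.nijenhuisAux_tensorial_right X x)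

theorem nijenhuis_apply {X Y : Π x : M, TangentSpace I x} {x : M}
    (hX : MDiffAt (T% X) x) (hY : MDiffAt (T% Y) x) :
    J.nijenhuis x (X x) (Y x) = mlieBracket I (J.field X) (J.field Y) x
      - J.toFun x (mlieBracket I (J.field X) Y x)
      - J.toFun x (mlieBracket I X (J.field Y) x) - mlieBracket I X Y x :=
  TensorialAt.mkHom₂_apply _ _ hX hY

end AlmostComplexStructure

/-! ### Almost-Kähler structures -/

/-- A symplectic form on `M`: a smooth 2-form that is closed and nondegenerate. -/
structure SymplecticForm {E : Type*} [NormedAddCommGroup E] [NormedSpace ℝ E]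
    {H : Type*} [TopologicalSpace H] (I : ModelWithCorners ℝ E H)
    (M : Type*) [TopologicalSpace M] [ChartedSpace H M] [IsManifold I ∞ M] where
  /-- the bilinear form on each tangent space -/
  toFun : BilinField I M
  smooth : toFun.IsSmooth
  alternating : ∀ (x : M) (v : TangentSpace I x), toFun x v v = 0
  nondegenerate : ∀ (x : M) (v : TangentSpace I x), v ≠ 0 → ∃ w, toFun x v w ≠ 0
  /-- `dΩ = 0`. The vector fields only have to be differentiable at the point considered; `dΩ`
  depends only on their values there. -/
  closed : ∀ (x : M) (X Y Z : Π x : M, TangentSpace I x),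
    MDiffAt (T% X) x → MDiffAt (T% Y) x → MDiffAt (T% Z) x → extDerivTwo toFun X Y Z x = 0

/-- An almost-Kähler structure `(g, J, Ω)` on `M`: a symplectic form `Ω`, an almost-complex
structure `J` compatible with `Ω`, and the associated Riemannian metric `g = Ω(·, J ·)`. -/
structure AlmostKahlerStructure {E : Type*} [NormedAddCommGroup E] [NormedSpace ℝ E]
    {H : Type*} [TopologicalSpace H] (I : ModelWithCorners ℝ E H)
    (M : Type*) [TopologicalSpace M] [ChartedSpace H M] [IsManifold I ∞ M] where
  /-- the Riemannian metric -/
  g : RiemMetric I M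
  /-- the almost-complex structure -/
  J : AlmostComplexStructure I M
  /-- the symplectic form -/
  Ω : SymplecticForm I M
  invariant : ∀ (x : M) (v w : TangentSpace I x),
    Ω.toFun x (J.toFun x v) (J.toFun x w) = Ω.toFun x v w
  tame : ∀ (x : M) (v : TangentSpace I x), v ≠ 0 → 0 < Ω.toFun x v (J.toFun x v)
  metric_eq : ∀ (x : M) (v w : TangentSpace I x), g.inner x v w = Ω.toFun x v (J.toFun x w)

/-- The tensor `∇Ω`, where `∇` is the Levi-Civita connection of `g`. -/
def AlmostKahlerStructure.nablaOmega (S : AlmostKahlerStructure I M) (x : M) :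
    TangentSpace I x →L[ℝ] TangentSpace I x →L[ℝ] TangentSpace I x →L[ℝ] ℝ :=
  covDeriv (leviCivita S.g) S.Ω.smooth x

end AlmostKahler

end

/-! Write `T(u, v, w) = (∇_w ω)(u, v)`. Since `ω = g(J ·, ·)` and `∇g = 0`, also
`T(u, v, w) = g((∇_w J) u, v)`, and `J² = -1` makes `∇J` anticommute with `J`; hence
`T(Ju, v, w) = T(u, Jv, w)`. For a torsion-free connection, Lie brackets are differences of
covariant derivatives, which turns `N` into an expression in `∇J` and `dω` into the cyclic sum
of `T`. Combining the two gives `g(N(u, v), w) = -2 T(Ju, v, w)`, and `J` is invertible. -/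

noncomputable section

namespace AlmostKahler

section VectorBundle

variable {𝕜 : Type*} [NontriviallyNormedField 𝕜]
  {E : Type*} [NormedAddCommGroup E] [NormedSpace 𝕜 E]
  {H : Type*} [TopologicalSpace H] {I : ModelWithCorners 𝕜 E H}
  {M : Type*} [TopologicalSpace M] [ChartedSpace H M]
  {F : Type*} [NormedAddCommGroup F] [NormedSpace 𝕜 F]
  {V : M → Type*} [TopologicalSpace (TotalSpace F V)] [∀ x, AddCommGroup (V x)]
  [∀ x, Module 𝕜 (V x)] [∀ x, TopologicalSpace (V x)] [FiberBundle F V]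

variable (I F) in
theorem exists_mdifferentiableAt_section_eq [VectorBundle 𝕜 F V] [ContMDiffVectorBundle 1 F V I]
    {x : M} (v : V x) : ∃ σ : Π y, V y, MDiffAt (T% σ) x ∧ σ x = v :=
  ⟨extend F v, mdifferentiableAt_extend .., extend_apply_self ..⟩

theorem covariantDerivative_neg [∀ x, IsTopologicalAddGroup (V x)] [∀ x, ContinuousSMul 𝕜 (V x)]
    (cov : CovariantDerivative I F V) {σ : Π x, V x} {x : M} (hσ : MDiffAt (T% σ) x) :
    cov (-σ) x = -cov σ x := by
  simpa only [neg_one_smul] using cov.isCovariantDerivativeOn.smul_const (-1) hσ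

end VectorBundle

variable {E : Type*} [NormedAddCommGroup E] [NormedSpace ℝ E]
  {H : Type*} [TopologicalSpace H] {I : ModelWithCorners ℝ E H}
  {M : Type*} [TopologicalSpace M] [ChartedSpace H M]

/-- A field of alternating bilinear forms, i.e. a (not necessarily smooth) 2-form. -/
def BilinField.IsAlternating (B : BilinField I M) : Prop :=
  ∀ (x : M) (v : TangentSpace I x), B x v v = 0

theorem BilinField.IsAlternating.swap {B : BilinField I M} (hB : B.IsAlternating) (x : M)
    (v w : TangentSpace I x) : B x v w = -B x w v :=
  (LinearMap.IsAlt.neg (B := (B x).toLinearMap₁₂) (hB x) w v).symm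

variable [IsManifold I ∞ M]

/-- Torsion-freeness of a connection on the tangent bundle. It is spelled out on vector fields
because Mathlib's torsion tensor takes the completeness of `E` as a separate instance argument;
compare `CovariantDerivative.torsion_eq_zero_iff`. -/
def IsTorsionFree (cov : CovariantDerivative I E (fun x : M ↦ TangentSpace I x)) : Prop :=
  ∀ {X Y : Π x : M, TangentSpace I x} {x : M}, MDiffAt (T% X) x → MDiffAt (T% Y) x →
    cov Y x (X x) - cov X x (Y x) = mlieBracket I X Y x

theorem AlmostComplexStructure.field_field (J : AlmostComplexStructure I M)
    (X : Π x : M, TangentSpace I x) : J.field (J.field X) = -X :=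
  funext fun x ↦ J.sq_eq_neg x (X x)

theorem AlmostKahlerStructure.omega_eq_inner (S : AlmostKahlerStructure I M) (x : M)
    (v w : TangentSpace I x) :
    S.Ω.toFun x v w = S.g.inner x (S.J.toFun x v) w := by
  rw [S.metric_eq, S.invariant]

theorem AlmostKahlerStructure.inner_J_left (S : AlmostKahlerStructure I M) (x : M)
    (v w : TangentSpace I x) :
    S.g.inner x (S.J.toFun x v) w = -S.g.inner x v (S.J.toFun x w) := by
  rw [← S.omega_eq_inner, S.metric_eq, S.J.sq_eq_neg, map_neg, neg_neg]

variable [FiniteDimensional ℝ E]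

theorem isTorsionFree_leviCivita (g : RiemMetric I M) : IsTorsionFree (leviCivita g) :=
  leviCivita_torsion g

section TwoForms

variable (cov : CovariantDerivative I E (fun x : M ↦ TangentSpace I x)) {Ω : BilinField I M}

theorem covDeriv_swap (hΩ : Ω.IsSmooth) (halt : Ω.IsAlternating) {x : M}
    (u v w : TangentSpace I x) : covDeriv cov hΩ x u v w = -covDeriv cov hΩ x v u w := by
  obtain ⟨X, hX, rfl⟩ := exists_mdifferentiableAt_section_eq I E u
  obtain ⟨Y, hY, rfl⟩ := exists_mdifferentiableAt_section_eq I E v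
  obtain ⟨Z, -, rfl⟩ := exists_mdifferentiableAt_section_eq I E w
  have hXY : (fun y ↦ Ω y (X y) (Y y)) = fun y ↦ -Ω y (Y y) (X y) :=
    funext fun y ↦ halt.swap y _ _
  rw [covDeriv_apply cov hΩ hX hY, covDeriv_apply cov hΩ hY hX, hXY, mvfderiv_fun_neg,
    halt.swap x _ (Y x), halt.swap x (X x), neg_apply]
  ring

variable {cov}

theorem IsTorsionFree.extDerivTwo_eq (hcov : IsTorsionFree cov) (hΩ : Ω.IsSmooth)
    (halt : Ω.IsAlternating) {X Y Z : Π x : M, TangentSpace I x} {x : M}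
    (hX : MDiffAt (T% X) x) (hY : MDiffAt (T% Y) x) (hZ : MDiffAt (T% Z) x) :
    extDerivTwo Ω X Y Z x = covDeriv cov hΩ x (Y x) (Z x) (X x)
      - covDeriv cov hΩ x (X x) (Z x) (Y x) + covDeriv cov hΩ x (X x) (Y x) (Z x) := by
  rw [extDerivTwo, ← hcov hX hY, ← hcov hX hZ, ← hcov hY hZ, covDeriv_apply cov hΩ hY hZ,
    covDeriv_apply cov hΩ hX hZ, covDeriv_apply cov hΩ hX hY, halt.swap x (Y x),
    halt.swap x (X x) (cov Z x (Y x)), halt.swap x (X x) (cov Y x (Z x))]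
  simp only [map_sub, sub_apply]
  ring

end TwoForms

namespace AlmostComplexStructure

variable (J : AlmostComplexStructure I M)
  (cov : CovariantDerivative I E (fun x : M ↦ TangentSpace I x))

theorem covDeriv_tensorial (x : M) :
    TensorialAt I E (fun Y ↦ cov (J.field Y) x - (J.toFun x).comp (cov Y x)) x where
  smul {f Y} hf hY := by
    ext u
    simp only [field_smul, cov.isCovariantDerivativeOn.leibniz hY hf,
      cov.isCovariantDerivativeOn.leibniz (J.mdifferentiableAt_field hY) hf]
    simp only [field, ContinuousLinearMap.comp_add, ContinuousLinearMap.comp_smulₛₗ,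
      Real.ringHom_apply, sub_apply, add_apply, smul_apply, ContinuousLinearMap.smulRight_apply,
      ContinuousLinearMap.comp_apply, map_smul, add_sub_add_right_eq_sub]
    module
  add {Y Y'} hY hY' := by
    ext u
    simp only [field_add, cov.isCovariantDerivativeOn.add hY hY',
      cov.isCovariantDerivativeOn.add (J.mdifferentiableAt_field hY)
      (J.mdifferentiableAt_field hY')]
    simp only [ContinuousLinearMap.comp_add, sub_apply, add_apply, ContinuousLinearMap.comp_apply]
    abel

/-- The covariant derivative `∇J` of an almost-complex structure, as a tensor. As for
`AlmostKahler.covDeriv`, the direction comes last: `J.covDeriv cov x v u` is `(∇_u J) v`. -/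
def covDeriv (x : M) : TangentSpace I x →L[ℝ] TangentSpace I x →L[ℝ] TangentSpace I x :=
  TensorialAt.mkHom (fun Y ↦ cov (J.field Y) x - (J.toFun x).comp (cov Y x)) x
    (J.covDeriv_tensorial cov x)

theorem covDeriv_apply {Y : Π x : M, TangentSpace I x} {x : M} (hY : MDiffAt (T% Y) x)
    (u : TangentSpace I x) :
    J.covDeriv cov x (Y x) u = cov (J.field Y) x u - J.toFun x (cov Y x u) := by
  rw [covDeriv, TensorialAt.mkHom_apply _ hY]
  rfl

theorem covDeriv_J (x : M) (v u : TangentSpace I x) :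
    J.covDeriv cov x (J.toFun x v) u = -J.toFun x (J.covDeriv cov x v u) := by
  obtain ⟨Y, hY, rfl⟩ := exists_mdifferentiableAt_section_eq I E v
  calc J.covDeriv cov x (J.field Y x) u
      = cov (J.field (J.field Y)) x u - J.toFun x (cov (J.field Y) x u) :=
        J.covDeriv_apply cov (J.mdifferentiableAt_field hY) u
    _ = -cov Y x u - J.toFun x (cov (J.field Y) x u) := by
        rw [J.field_field, covariantDerivative_neg cov hY, neg_apply]
    _ = -J.toFun x (J.covDeriv cov x (Y x) u) := by
        rw [J.covDeriv_apply cov hY, map_sub, J.sq_eq_neg]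
        abel

variable {cov}

theorem nijenhuis_eq_covDeriv (hcov : IsTorsionFree cov) (x : M) (u v : TangentSpace I x) :
    J.nijenhuis x u v = J.covDeriv cov x v (J.toFun x u) - J.covDeriv cov x u (J.toFun x v)
      + J.toFun x (J.covDeriv cov x u v) - J.toFun x (J.covDeriv cov x v u) := by
  obtain ⟨X, hX, rfl⟩ := exists_mdifferentiableAt_section_eq I E u
  obtain ⟨Y, hY, rfl⟩ := exists_mdifferentiableAt_section_eq I E v
  have hJX := J.mdifferentiableAt_field hX
  have hJY := J.mdifferentiableAt_field hY
  rw [J.nijenhuis_apply hX hY, ← hcov hJX hJY, ← hcov hJX hY, ← hcov hX hJY, ← hcov hX hY]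
  simp only [J.covDeriv_apply cov hX, J.covDeriv_apply cov hY, field, map_sub, J.sq_eq_neg]
  abel

end AlmostComplexStructure

namespace SymplecticForm

variable (Ω : SymplecticForm I M) {cov : CovariantDerivative I E (fun x : M ↦ TangentSpace I x)}

theorem covDeriv_sub_covDeriv (hcov : IsTorsionFree cov) (x : M) (u v w : TangentSpace I x) :
    covDeriv cov Ω.smooth x u w v - covDeriv cov Ω.smooth x v w u
      = covDeriv cov Ω.smooth x u v w := by
  obtain ⟨X, hX, rfl⟩ := exists_mdifferentiableAt_section_eq I E u
  obtain ⟨Y, hY, rfl⟩ := exists_mdifferentiableAt_section_eq I E v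
  obtain ⟨Z, hZ, rfl⟩ := exists_mdifferentiableAt_section_eq I E w
  have hclosed := Ω.closed x X Y Z hX hY hZ
  rw [hcov.extDerivTwo_eq Ω.smooth Ω.alternating hX hY hZ] at hclosed
  linarith

end SymplecticForm

namespace AlmostKahlerStructure

variable (S : AlmostKahlerStructure I M)

theorem nablaOmega_eq_inner (x : M) (u v w : TangentSpace I x) :
    S.nablaOmega x u v w = S.g.inner x (S.J.covDeriv (leviCivita S.g) x u w) v := by
  obtain ⟨X, hX, rfl⟩ := exists_mdifferentiableAt_section_eq I E u
  obtain ⟨Y, hY, rfl⟩ := exists_mdifferentiableAt_section_eq I E v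
  obtain ⟨Z, hZ, rfl⟩ := exists_mdifferentiableAt_section_eq I E w
  have hΩ : (fun y ↦ S.Ω.toFun y (X y) (Y y)) = fun y ↦ S.g.inner y (S.J.field X y) (Y y) :=
    funext fun y ↦ S.omega_eq_inner y _ _
  rw [nablaOmega, covDeriv_apply _ S.Ω.smooth hX hY, hΩ,
    leviCivita_metric S.g hZ (S.J.mdifferentiableAt_field hX) hY, S.omega_eq_inner,
    S.omega_eq_inner, S.J.covDeriv_apply _ hX, map_sub, sub_apply]
  simp only [AlmostComplexStructure.field]
  ring

theorem nablaOmega_swap (x : M) (u v w : TangentSpace I x) :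
    S.nablaOmega x u v w = -S.nablaOmega x v u w :=
  covDeriv_swap _ S.Ω.smooth S.Ω.alternating u v w

theorem nablaOmega_sub_nablaOmega (x : M) (u v w : TangentSpace I x) :
    S.nablaOmega x u w v - S.nablaOmega x v w u = S.nablaOmega x u v w :=
  S.Ω.covDeriv_sub_covDeriv (isTorsionFree_leviCivita S.g) x u v w

theorem nablaOmega_J_left (x : M) (u v w : TangentSpace I x) :
    S.nablaOmega x (S.J.toFun x u) v w = S.nablaOmega x u (S.J.toFun x v) w := by
  simp only [nablaOmega_eq_inner, S.J.covDeriv_J, map_neg, neg_apply, S.inner_J_left, neg_neg]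

theorem inner_nijenhuis (x : M) (u v w : TangentSpace I x) :
    S.g.inner x (S.J.nijenhuis x u v) w = -2 * S.nablaOmega x (S.J.toFun x u) v w := by
  calc S.g.inner x (S.J.nijenhuis x u v) w
      = S.nablaOmega x v w (S.J.toFun x u) - S.nablaOmega x u w (S.J.toFun x v)
        - S.nablaOmega x u (S.J.toFun x w) v + S.nablaOmega x v (S.J.toFun x w) u := by
        rw [S.J.nijenhuis_eq_covDeriv (isTorsionFree_leviCivita S.g)]
        simp only [map_add, map_sub, add_apply, sub_apply, S.inner_J_left, nablaOmega_eq_inner]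
        ring
    _ = (S.nablaOmega x (S.J.toFun x v) w u - S.nablaOmega x u w (S.J.toFun x v))
        - (S.nablaOmega x (S.J.toFun x u) w v - S.nablaOmega x v w (S.J.toFun x u)) := by
        rw [S.nablaOmega_J_left x v w u, S.nablaOmega_J_left x u w v]
        ring
    _ = S.nablaOmega x (S.J.toFun x v) u w - S.nablaOmega x (S.J.toFun x u) v w := by
        rw [S.nablaOmega_sub_nablaOmega, S.nablaOmega_sub_nablaOmega]
    _ = -2 * S.nablaOmega x (S.J.toFun x u) v w := by
        rw [S.nablaOmega_swap x _ u w, ← S.nablaOmega_J_left]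
        ring

theorem nablaOmega_eq_inner_nijenhuis (x : M) (u v w : TangentSpace I x) :
    S.nablaOmega x u v w = (1 / 2) * S.g.inner x (S.J.nijenhuis x (S.J.toFun x u) v) w := by
  rw [S.inner_nijenhuis, S.nablaOmega_J_left, S.nablaOmega_J_left, S.J.sq_eq_neg,
    (S.nablaOmega x u).map_neg₂]
  ring

theorem nijenhuis_eq_zero_iff (x : M) : S.J.nijenhuis x = 0 ↔ S.nablaOmega x = 0 where
  mp hN := by
    refine DFunLike.ext _ _ fun u ↦ DFunLike.ext _ _ fun v ↦ DFunLike.ext _ _ fun w ↦ ?_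
    rw [nablaOmega_eq_inner_nijenhuis, hN]
    simp
  mpr hΩ := by
    refine DFunLike.ext _ _ fun u ↦ DFunLike.ext _ _ fun v ↦ S.g.ext_left fun w ↦ ?_
    rw [inner_nijenhuis, hΩ]
    simp

end AlmostKahlerStructure

end AlmostKahler

end

theorem proposition1 {E : Type*} [NormedAddCommGroup E] [NormedSpace ℝ E] [FiniteDimensional ℝ E]
    {H : Type*} [TopologicalSpace H] {I : ModelWithCorners ℝ E H}
    {M : Type*} [TopologicalSpace M] [ChartedSpace H M] [IsManifold I ∞ M]
    (S : AlmostKahler.AlmostKahlerStructure I M) :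
    {x : M | S.J.nijenhuis x = 0} = {x : M | S.nablaOmega x = 0} :=
  Set.ext S.nijenhuis_eq_zero_iff
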